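/- An \emph{ortholattice} (OL) is a bounded lattice with a unary operation $'$ such that $a\le b$ implies $b'\le a'$, $a''=a$, $a\cap a'=0$ and $a\cup a'=1$; it is an \emph{orthomodular lattice} (OML) if $a\le b$ implies $a\cup(a'\cap b)=b$. Write $a\to b:=a'\cup(a\cap b)$, and $a\perp b$ for $a\le b'$. For $n\ge 3$ define $\overset{(n)}{\equiv}$, an operation on two explicit arguments $x,y$ and parameters $a_3,\dots,a_n$, by $$x\overset{(3)}{\equiv}y:=\bigl((x\to a_3)\cap(y\to a_3)\bigr)\cup\bigl((x'\to a_3)\cap(y'\to a_3)\bigr),$$ $$x\overset{(n)}{\equiv}y:=(x\overset{(n-1)}{\equiv}y)\cup\bigl((x\overset{(n-1)}{\equiv}a_n)\cap(y\overset{(n-1)}{\equiv}a_n)\bigr)\qquad(n\ge4).$$ The \emph{$n$OA law} is: $(a_1\to a_3)\cap(a_1\overset{(n)}{\equiv}a_2)\le a_2\to a_3$ for all $a_1,\dots,a_n$. For $n\ge3$, an OL is an \emph{$n$GO} if for all $a_1,\dots,a_n$ $$(a_1\to a_2)\cap(a_2\to a_3)\cap\cdots\cap(a_{n-1}\to a_n)\cap(a_n\to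 a_1)=(a_n\to a_{n-1})\cap(a_{n-1}\to a_{n-2})\cap\cdots\cap(a_2\to a_1)\cap(a_1\to a_n).$$ A \emph{Mayet--Godowski equation} is an equality $t_1\cap\cdots\cap t_n=u_1\cap\cdots\cap u_n$ with $n\ge2$, where each $t_i$ and each $u_i$ is a join of one or more distinct variables and each variable occurs the same number of times on both sides. It holds in an OL if it is true for every assignment of elements to the variables under which, for each single term $t_i$ or $u_i$, the variables in that term are mutually orthogonal. An OL is an \emph{MGO} if all Mayet--Godowski equations hold in it. \textbf{Theorem.} There is a finite OML that satisfies the $n$OA laws for $n=3,4,5,6$ but is not a $3$GO; it is not an $n$GO for any $n\ge3$, and it is not an MGO. -/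

import Mathlib

/-- An ortholattice: a bounded lattice with an orthocomplementation `ᶜ`. -/
class Ortholattice (L : Type*) extends Lattice L, BoundedOrder L, Compl L where
  compl_antitone : ∀ a b : L, a ≤ b → bᶜ ≤ aᶜ
  compl_involutive : ∀ a : L, aᶜᶜ = a
  inf_compl : ∀ a : L, a ⊓ aᶜ = ⊥
  sup_compl : ∀ a : L, a ⊔ aᶜ = ⊤

/-- An orthomodular lattice (OML): an ortholattice in which `a ≤ b` implies
`a ∪ (a' ∩ b) = b`. -/
class OrthomodularLattice (L : Type*) extends Ortholattice L where
  orthomodular : ∀ a b : L, a ≤ b → a ⊔ (aᶜ ⊓ b) = b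

namespace Ortholattice

/-- The implication `a → b`, that is, `a' ∪ (a ∩ b)`. -/
def imp {L : Type*} [Ortholattice L] (a b : L) : L := aᶜ ⊔ (a ⊓ b)

/-- Orthogonality `a ⊥ b`, that is, `a ≤ b'`. -/
def Orth {L : Type*} [Ortholattice L] (a b : L) : Prop := a ≤ bᶜ

/-- `oaEquiv a n x y` is the expression `x ≡⁽ⁿ⁾ y` with remaining variables `a 3, …, a n`.
For `n = 3` it is `((x → a₃) ∩ (y → a₃)) ∪ ((x' → a₃) ∩ (y' → a₃))`, and for `n ≥ 4` it is
`(x ≡⁽ⁿ⁻¹⁾ y) ∪ ((x ≡⁽ⁿ⁻¹⁾ aₙ) ∩ (y ≡⁽ⁿ⁻¹⁾ aₙ))`.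
It is meant for `n ≥ 3` only (smaller `n` return the expression for `n = 3`). -/
def oaEquiv {L : Type*} [Ortholattice L] (a : ℕ → L) : ℕ → L → L → L
  | n + 4, x, y =>
      oaEquiv a (n + 3) x y ⊔
        (oaEquiv a (n + 3) x (a (n + 4)) ⊓ oaEquiv a (n + 3) y (a (n + 4)))
  | _, x, y => (imp x (a 3) ⊓ imp y (a 3)) ⊔ (imp xᶜ (a 3) ⊓ imp yᶜ (a 3))

/-- The `n`OA law (`n ≥ 3`): `(a₁ → a₃) ∩ (a₁ ≡⁽ⁿ⁾ a₂) ≤ a₂ → a₃` for all `a₁, …, aₙ`. -/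
def IsOA (n : ℕ) (L : Type*) [Ortholattice L] : Prop :=
  ∀ a : ℕ → L, imp (a 1) (a 3) ⊓ oaEquiv a n (a 1) (a 2) ≤ imp (a 2) (a 3)

/-- The Godowski identity
`(a₁ → a₂) ∩ (a₂ → a₃) ∩ ⋯ ∩ (aₙ₋₁ → aₙ) ∩ (aₙ → a₁)`. -/
def godowski {L : Type*} [Ortholattice L] (n : ℕ) (a : ℕ → L) : L :=
  (Finset.Ico 1 n).inf (fun i => imp (a i) (a (i + 1))) ⊓ imp (a n) (a 1)

/-- `L` is an `n`GO (`n ≥ 3`): the Godowski identity in `a₁, …, aₙ` always has the same value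
as the one in which `aᵢ` and `aₙ₋ᵢ₊₁` are swapped. -/
def IsGO (n : ℕ) (L : Type*) [Ortholattice L] : Prop :=
  ∀ a : ℕ → L, godowski n a = godowski n (fun i => a (n + 1 - i))

end Ortholattice

/-- A Mayet-Godowski equation `t₁ ∩ ⋯ ∩ tₙ = u₁ ∩ ⋯ ∩ uₙ`, `n ≥ 2`. Variables are natural
numbers; each conjunct is the join of the variables in a nonempty finite set (`lhs i` for `tᵢ`,
`rhs i` for `uᵢ`); each variable occurs equally often on both sides. -/
structure MayetGodowskiEquation where
  n : ℕ
  two_le : 2 ≤ n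
  lhs : Fin n → Finset ℕ
  rhs : Fin n → Finset ℕ
  lhs_nonempty : ∀ i, (lhs i).Nonempty
  rhs_nonempty : ∀ i, (rhs i).Nonempty
  balanced : ∀ v : ℕ,
    (Finset.univ.filter fun i => v ∈ lhs i).card = (Finset.univ.filter fun i => v ∈ rhs i).card

namespace MayetGodowskiEquation

/-- The equation holds in `L`: it is true under every assignment for which the variables within
each single term are mutually orthogonal. -/
def Holds (E : MayetGodowskiEquation) (L : Type*) [Ortholattice L] : Prop :=
  ∀ a : ℕ → L,
    (∀ i, ∀ v ∈ E.lhs i, ∀ w ∈ E.lhs i, v ≠ w → Ortholattice.Orth (a v) (a w)) →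
    (∀ i, ∀ v ∈ E.rhs i, ∀ w ∈ E.rhs i, v ≠ w → Ortholattice.Orth (a v) (a w)) →
    (Finset.univ.inf fun i => (E.lhs i).sup a) = Finset.univ.inf fun i => (E.rhs i).sup a

end MayetGodowskiEquation

/-- `L` is an MGO: all Mayet-Godowski equations hold in `L`. -/
def Ortholattice.IsMGO (L : Type*) [Ortholattice L] : Prop :=
  ∀ E : MayetGodowskiEquation, E.Holds L

/-!
# An orthomodular lattice satisfying every `n`OA law and violating every `n`GO law

The lattice is the one with Greechie diagram the wheel with three spokes: its atoms are
`p, x₁, x₂, x₃, z₁, z₂, z₃, a, b, c, d, e, f, y₁, y₂, y₃` and its blocks are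
`{p, xᵢ, zᵢ}` (spokes), `{a, b, x₁}`, `{c, d, x₂}`, `{e, f, x₃}`, and
`{b, c, y₁}`, `{d, e, y₂}`, `{f, a, y₃}`.

An element is represented by the set of atoms below it, coded as a natural number whose binary
digit `i` says whether the `i`-th atom (in the order above) belongs to the set; meet is then
bitwise conjunction.
-/

/-! ### Reductions valid in every ortholattice. -/

namespace Ortholattice

variable {L : Type*} [Ortholattice L]

/-! Fix c = a₃. The operations ≡⁽ⁿ⁾ grow with n, but any F above ≡⁽³⁾ with F(x,z) ∩ F(y,z) ≤ F(x,y)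
absorbs each recursion step, so it bounds all of them. If also (x → c) ∩ F(x,y) ≤ y → c, every nOA
law follows at once. In the wheel, a single closure step, F(x,y) = ⋃_z (x ≡⁽³⁾ z) ∩ (y ≡⁽³⁾ z), is
already enough; this is a finite check over c, x, y, z (`check_codes`).

The Godowski and Mayet-Godowski equations fail on the rim: a ∪ b, c ∪ d, e ∪ f are x₁', x₂', x₃',
whose meet is the hub p, while b ∪ c, d ∪ e, f ∪ a are y₁', y₂', y₃', whose meet is 0. Failure of
3GO passes to every n ≥ 3 by repeating a variable (`IsGO.three`). -/

/-- If every `c` admits an upper bound `F` of `≡⁽³⁾` which is transitive and satisfies the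
conclusion of the `n`OA law, then all `n`OA laws hold. -/
theorem isOA_of_transitive_bound
    (h : ∀ c : L, ∃ F : L → L → L,
      (∀ x y, (imp x c ⊓ imp y c) ⊔ (imp xᶜ c ⊓ imp yᶜ c) ≤ F x y) ∧
      (∀ x y z, F x z ⊓ F y z ≤ F x y) ∧
      ∀ x y, imp x c ⊓ F x y ≤ imp y c) (n : ℕ) : IsOA n L := by
  intro a
  obtain ⟨F, h3, ht, hl⟩ := h (a 3)
  have key : ∀ n x y, oaEquiv a n x y ≤ F x y := by
    intro n
    induction n with
    | zero => intro x y; exact h3 x y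
    | succ n ih =>
      intro x y
      -- `oaEquiv` has the same value at all indices up to 3; the recursion starts at 4.
      match n, ih with
      | 0, _ => exact h3 x y
      | 1, _ => exact h3 x y
      | 2, _ => exact h3 x y
      | n + 3, ih =>
        exact sup_le (ih x y) ((inf_le_inf (ih _ _) (ih _ _)).trans (ht _ _ _))
  exact (inf_le_inf le_rfl (key n _ _)).trans (hl _ _)

theorem imp_self (x : L) : imp x x = ⊤ := by
  rw [imp, inf_idem, sup_comm, sup_compl]

/-- An `n`GO with `n ≥ 3` is a `3`GO. -/
theorem IsGO.three {n : ℕ} (hn : 3 ≤ n) (h : IsGO n L) : IsGO 3 L := by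
  intro a
  obtain ⟨m, rfl⟩ := Nat.exists_eq_add_of_le' hn
  -- With the sequence constant from a₃ on, the surplus conjuncts are a₃ → a₃ = 1.
  have key := h fun i => a (min i 3)
  have left : godowski (m + 3) (fun i => a (min i 3)) = godowski 3 a := by
    apply le_antisymm
    · refine le_inf (Finset.le_inf fun i hi => ?_) ?_
      · have hi' := Finset.mem_Ico.1 hi
        have : i ∈ Finset.Ico 1 (m + 3) := Finset.mem_Ico.2 (by omega)
        refine inf_le_left.trans ((Finset.inf_le this).trans (le_of_eq ?_))
        simp only []
        rw [min_eq_left (by omega), min_eq_left (by omega)]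
      · refine inf_le_right.trans (le_of_eq ?_)
        simp
    · refine le_inf (Finset.le_inf fun i hi => ?_) ?_
      · have hi' := Finset.mem_Ico.1 hi
        rcases lt_or_ge i 3 with h3 | h3
        · have : i ∈ Finset.Ico 1 3 := Finset.mem_Ico.2 (by omega)
          refine inf_le_left.trans ((Finset.inf_le this).trans (le_of_eq ?_))
          simp only []
          rw [min_eq_left (by omega), min_eq_left (by omega)]
        · simp only []
          rw [min_eq_right h3, min_eq_right (by omega), imp_self]
          exact le_top
      · refine inf_le_right.trans (le_of_eq ?_)
        simp
  have right : godowski (m + 3) (fun i => a (min (m + 3 + 1 - i) 3))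
      = godowski 3 fun i => a (3 + 1 - i) := by
    apply le_antisymm
    · refine le_inf (Finset.le_inf fun i hi => ?_) ?_
      · have hi' := Finset.mem_Ico.1 hi
        -- Reversal moves the constant stretch to the front, so indices shift by m.
        have : m + i ∈ Finset.Ico 1 (m + 3) := Finset.mem_Ico.2 (by omega)
        refine inf_le_left.trans ((Finset.inf_le this).trans (le_of_eq ?_))
        simp only []
        congr 2 <;> omega
      · refine inf_le_right.trans (le_of_eq ?_)
        simp only []
        congr 2 <;> omega
    · refine le_inf (Finset.le_inf fun i hi => ?_) ?_
      · have hi' := Finset.mem_Ico.1 hi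
        rcases lt_or_ge m i with h3 | h3
        · have : i - m ∈ Finset.Ico 1 3 := Finset.mem_Ico.2 (by omega)
          refine inf_le_left.trans ((Finset.inf_le this).trans (le_of_eq ?_))
          simp only []
          congr 2 <;> omega
        · simp only []
          rw [min_eq_right (by omega), min_eq_right (by omega), imp_self]
          exact le_top
      · refine inf_le_right.trans (le_of_eq ?_)
        simp only []
        congr 2 <;> omega
  rw [← left, ← right]
  exact key

/-- The Mayet-Godowski equation
`(v₀ ∪ v₁) ∩ (v₂ ∪ v₃) ∩ (v₄ ∪ v₅) = (v₁ ∪ v₂) ∩ (v₃ ∪ v₄) ∩ (v₅ ∪ v₀)`. -/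
def hexagonEquation : MayetGodowskiEquation where
  n := 3
  two_le := by norm_num
  lhs := ![{0, 1}, {2, 3}, {4, 5}]
  rhs := ![{1, 2}, {3, 4}, {5, 0}]
  lhs_nonempty i := by fin_cases i <;> simp
  rhs_nonempty i := by fin_cases i <;> simp
  balanced v := by
    by_cases hv : v < 6
    · interval_cases v <;> decide
    · have l : ∀ i : Fin 3, v ∉ (![{0, 1}, {2, 3}, {4, 5}] : Fin 3 → Finset ℕ) i := by
        intro i; fin_cases i <;> simp <;> omega
      have r : ∀ i : Fin 3, v ∉ (![{1, 2}, {3, 4}, {5, 0}] : Fin 3 → Finset ℕ) i := by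
        intro i; fin_cases i <;> simp <;> omega
      simp only [l, r]

end Ortholattice

/-! ### The wheel as a finite orthomodular lattice. -/

namespace WheelLattice

/-- The codes of the 34 elements. -/
def codes : List ℕ :=
  [0, 1, 2, 3, 4, 5, 8, 9, 16, 32, 64, 126, 128, 256, 401, 512, 768, 1024, 1569, 2048, 3072, 4096,
    4224, 6209, 8192, 8834, 9476, 16384, 18948, 21512, 32768, 34952, 37122, 65535]

/-- The orthocomplements of all elements: that of the element `m` stands at the position
`m % 113` in base `2 ^ 16`. -/
def complTable : ℕ :=
  0xc00108000000000000000080000000000000000000000000004000000000200000000000000000000000000200000000000000000000000000000000000000000000000000004000000000000000000000000000000000000000000000000000009000000020000250400000080000003000000000000000000000000000000000000000000000000008000080000000000000000000000000010000000000000050000228200008888000000000000000000000000400001000000000000000003910254080001000000000000004018414a0400000020062100100191007effff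

/-- Orthocomplementation of codes. -/
def compl (m : ℕ) : ℕ := (complTable >>> (16 * (m % 113))) % 65536

/-- Join of codes. -/
def join (a b : ℕ) : ℕ := compl (compl a &&& compl b)

/-- The implication `a → b` on codes. -/
def impl (a b : ℕ) : ℕ := join (compl a) (a &&& b)

/-- The order of codes: inclusion of sets of atoms. -/
def le (a b : ℕ) : Bool := Nat.beq (a &&& b) a

theorem le_iff {a b : ℕ} : le a b = true ↔ a &&& b = a := Nat.beq_eq ▸ Iff.rfl

theorem lt_of_mem : ∀ a ∈ codes, a < 65536 := by decide +kernel

theorem land_mem : ∀ a ∈ codes, ∀ b ∈ codes, a &&& b ∈ codes := by decide +kernel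

theorem compl_mem : ∀ a ∈ codes, compl a ∈ codes := by decide +kernel

/-- Since `compl` looks only at residues modulo 113, this also shows that these residues separate
the codes. -/
theorem compl_compl : ∀ a ∈ codes, compl (compl a) = a := by decide +kernel

theorem land_compl : ∀ a ∈ codes, a &&& compl a = 0 := by decide +kernel

theorem land_top : ∀ a ∈ codes, a &&& 65535 = a := by decide +kernel

theorem compl_land_compl :
    ∀ a ∈ codes, ∀ b ∈ codes, a &&& b = a → compl b &&& compl a = compl b := by decide +kernel

theorem join_orthomodular :
    ∀ a ∈ codes, ∀ b ∈ codes, a &&& b = a → join a (compl a &&& b) = b := by decide +kernel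

theorem join_mem {a b : ℕ} (ha : a ∈ codes) (hb : b ∈ codes) : join a b ∈ codes :=
  compl_mem _ (land_mem _ (compl_mem _ ha) _ (compl_mem _ hb))

theorem impl_mem {a b : ℕ} (ha : a ∈ codes) (hb : b ∈ codes) : impl a b ∈ codes :=
  join_mem (compl_mem _ ha) (land_mem _ ha _ hb)

/-- The lattice of the three-spoked wheel. -/
def Wheel : Type := {m : ℕ // m ∈ codes}

instance : Finite Wheel := inferInstanceAs (Finite {m : ℕ // m ∈ codes})

instance : PartialOrder Wheel where
  le a b := a.1 &&& b.1 = a.1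
  le_refl a := Nat.and_self _
  le_trans a b c hab hbc := by
    change a.1 &&& b.1 = a.1 at hab
    change b.1 &&& c.1 = b.1 at hbc
    rw [← hab, Nat.and_assoc, hbc]
  le_antisymm a b hab hba := by
    change a.1 &&& b.1 = a.1 at hab
    change b.1 &&& a.1 = b.1 at hba
    exact Subtype.ext (by rw [← hab, Nat.and_comm, hba])

instance : Compl Wheel := ⟨fun a => ⟨compl a.1, compl_mem _ a.2⟩⟩

theorem le_def {a b : Wheel} : a ≤ b ↔ a.1 &&& b.1 = a.1 := Iff.rfl

theorem wheel_compl_compl (a : Wheel) : aᶜᶜ = a := Subtype.ext (compl_compl _ a.2)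

theorem wheel_compl_antitone (a b : Wheel) (h : a ≤ b) : bᶜ ≤ aᶜ :=
  compl_land_compl _ a.2 _ b.2 h

instance : SemilatticeInf Wheel where
  inf a b := ⟨a.1 &&& b.1, land_mem _ a.2 _ b.2⟩
  inf_le_left a b := by
    change a.1 &&& b.1 &&& a.1 = a.1 &&& b.1
    rw [Nat.and_right_comm, Nat.and_self]
  inf_le_right a b := by
    change a.1 &&& b.1 &&& b.1 = a.1 &&& b.1
    rw [Nat.and_assoc, Nat.and_self]
  le_inf a b c hab hac := by
    change a.1 &&& (b.1 &&& c.1) = a.1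
    rw [← Nat.and_assoc, le_def.1 hab, le_def.1 hac]

instance : Lattice Wheel where
  sup a b := (aᶜ ⊓ bᶜ)ᶜ
  le_sup_left a b := by
    simpa only [wheel_compl_compl] using wheel_compl_antitone _ _ (inf_le_left (a := aᶜ) (b := bᶜ))
  le_sup_right a b := by
    simpa only [wheel_compl_compl] using wheel_compl_antitone _ _ (inf_le_right (a := aᶜ) (b := bᶜ))
  sup_le a b c hac hbc := by
    simpa only [wheel_compl_compl] using wheel_compl_antitone _ _
      (le_inf (wheel_compl_antitone _ _ hac) (wheel_compl_antitone _ _ hbc))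

instance : BoundedOrder Wheel where
  top := ⟨65535, by decide⟩
  le_top a := land_top _ a.2
  bot := ⟨0, by decide⟩
  bot_le _ := Nat.zero_and _

instance : OrthomodularLattice Wheel where
  compl_antitone := wheel_compl_antitone
  compl_involutive := wheel_compl_compl
  inf_compl a := Subtype.ext (land_compl _ a.2)
  sup_compl a := by
    refine Subtype.ext ?_
    change compl (compl a.1 &&& compl (compl a.1)) = 65535
    rw [land_compl _ (compl_mem _ a.2)]
    decide +kernel
  orthomodular a b h := Subtype.ext (join_orthomodular _ a.2 _ b.2 h)

/-! ### Evaluation of the transitive bound -/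

/-- `force n f` is `f n`, evaluated after `n` has been reduced to a literal. -/
def force {α : Type*} (n : ℕ) (f : ℕ → α) : α := Nat.rec (f 0) (fun k _ => f (Nat.succ k)) n

theorem force_eq {α : Type*} (n : ℕ) (f : ℕ → α) : force n f = f n := by
  cases n <;> rfl

/-- `List.map` in continuation-passing style. -/
def mapThen {α β : Type} (g : α → (β → Bool) → Bool) : List α → (List β → Bool) → Bool
  | [], k => k []
  | a :: l, k => g a fun b => mapThen g l fun r => k (b :: r)

/-- The continuation lets `force` reduce each entry to a literal before it enters the list, so later
stages do not recompute it; the result is the plain `List.map`. -/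
theorem mapThen_eq {α β : Type} {g : α → (β → Bool) → Bool} {f : α → β}
    (h : ∀ a k, g a k = k (f a)) (l : List α) (k : List β → Bool) :
    mapThen g l k = k (l.map f) := by
  induction l generalizing k with
  | nil => rfl
  | cons a l ih => rw [mapThen, h, ih, List.map_cons]

/-- A list of numbers below `2 ^ 16` as the digits of one number. -/
def pack : List ℕ → ℕ
  | [] => 0
  | a :: l => a + 65536 * pack l

theorem le_mod_div {m n : ℕ} (h : le m n = true) :
    le (m % 65536) (n % 65536) = true ∧ le (m / 65536) (n / 65536) = true := by
  simp only [le_iff] at *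
  refine ⟨?_, ?_⟩
  · conv_rhs => rw [← h]
    exact (Nat.and_mod_two_pow (n := 16)).symm
  · conv_rhs => rw [← h]
    exact (Nat.and_div_two_pow (n := 16)).symm

/-- Digits below 2 ^ 16 occupy disjoint bit ranges and multiplying the all-ones list by `b` causes
no carry, so one bitwise comparison of large numbers performs all the small ones. -/
theorem le_of_le_pack {α : Type*} {f g : α → ℕ} {b : ℕ} (hb : b < 65536) {l : List α}
    (hf : ∀ a ∈ l, f a < 65536) (hg : ∀ a ∈ l, g a < 65536)
    (h : le (pack (l.map f) &&& pack (l.map g)) (b * pack (l.map fun _ => 1)) = true) :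
    ∀ a ∈ l, le (f a &&& g a) b = true := by
  induction l with
  | nil => simp
  | cons a l ih =>
    simp only [List.map_cons, pack, List.forall_mem_cons] at h hf hg ⊢
    obtain ⟨h0, h1⟩ := le_mod_div h
    have e : b * (1 + 65536 * pack (l.map fun _ => 1))
        = b + 65536 * (b * pack (l.map fun _ => 1)) := by ring
    have hm : ∀ m n : ℕ, (m &&& n) % 65536 = (m % 65536) &&& (n % 65536) :=
      fun m n => Nat.and_mod_two_pow (n := 16)
    have hd : ∀ m n : ℕ, (m &&& n) / 65536 = (m / 65536) &&& (n / 65536) :=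
      fun m n => Nat.and_div_two_pow (n := 16)
    have m0 : ∀ {x : ℕ} (y : ℕ), x < 65536 → (x + 65536 * y) % 65536 = x := by omega
    have d0 : ∀ {x : ℕ} (y : ℕ), x < 65536 → (x + 65536 * y) / 65536 = y := by omega
    rw [e, hm, m0 _ hf.1, m0 _ hg.1, m0 _ hb] at h0
    rw [e, hd, d0 _ hf.1, d0 _ hg.1, d0 _ hb] at h1
    exact ⟨h0, ih hf.2 hg.2 h1⟩

/-- The values `x → c` and `x' → c`, on which the operation `≡⁽³⁾` depends. -/
structure ImpPair where
  pos : ℕ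
  neg : ℕ

/-- The operation `≡⁽³⁾`. -/
def equiv3 (s t : ImpPair) : ℕ := join (s.pos &&& t.pos) (s.neg &&& t.neg)

/-- The pair of `x`. -/
def impPair (c x : ℕ) : ImpPair := ⟨impl x c, impl (compl x) c⟩

/-- The pair of `x` with the list of all values `x ≡⁽³⁾ y`. -/
def row3 (S : List ImpPair) (s : ImpPair) : ImpPair × ℕ := (s, pack (S.map (equiv3 s)))

/-- The transitive bound: the join of all `(x ≡⁽³⁾ z) ∩ (y ≡⁽³⁾ z)`. It is `x ≡⁽³⁾ y` if that is
above all these meets, a case decided by comparing packed lists. -/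
def bound (S : List ImpPair) (s t : ImpPair × ℕ) : ℕ :=
  force (s.2 &&& t.2) fun r => force (equiv3 s.1 t.1) fun f =>
    bif le r (f * pack (codes.map fun _ => 1)) then f
    else S.foldr (fun w b => join b (equiv3 s.1 w &&& equiv3 t.1 w)) 0

/-- The row of `x` with the list of all values of the transitive bound. -/
def row4 (S : List ImpPair) (R : List (ImpPair × ℕ)) (s : ImpPair × ℕ) : (ImpPair × ℕ) × ℕ :=
  (s, pack (R.map (bound S s)))

/-- The three properties required of the transitive bound, the second one for all `z` at once. -/
def isGood (S : List ImpPair) (s t : (ImpPair × ℕ) × ℕ) : Bool :=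
  force (bound S s.1 t.1) fun f =>
    le (equiv3 s.1.1 t.1.1) f &&
      (le (s.2 &&& t.2) (f * pack (codes.map fun _ => 1)) && le (s.1.1.pos &&& f) t.1.1.pos)

/-- The transitive bound for the parameter `c` has the required properties. -/
def check (c : ℕ) : Bool :=
  mapThen (fun x k => force (impl x c) fun u => force (impl (compl x) c) fun v => k ⟨u, v⟩) codes
    fun S => mapThen (fun s k => force (row3 S s).2 fun r => k (s, r)) S
    fun R => mapThen (fun s k => force (row4 S R s).2 fun r => k (s, r)) R
    fun Q => Q.all fun s => Q.all fun t => isGood S s t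

theorem check_codes : ∀ c ∈ codes, check c = true := by decide +kernel

theorem check_eq (c : ℕ) :
    check c = ((((codes.map (impPair c)).map (row3 (codes.map (impPair c)))).map
      (row4 (codes.map (impPair c)) ((codes.map (impPair c)).map
        (row3 (codes.map (impPair c)))))).all fun s =>
      (((codes.map (impPair c)).map (row3 (codes.map (impPair c)))).map
      (row4 (codes.map (impPair c)) ((codes.map (impPair c)).map
        (row3 (codes.map (impPair c)))))).all fun t => isGood (codes.map (impPair c)) s t) := by
  rw [check, mapThen_eq (f := impPair c) (fun a k => by rw [force_eq, force_eq]; rfl),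
    mapThen_eq (f := row3 (codes.map (impPair c))) (fun a k => by rw [force_eq]; rfl),
    mapThen_eq (f := row4 (codes.map (impPair c)) _) (fun a k => by rw [force_eq]; rfl)]

/-- The transitive bound on codes. -/
def boundCode (c x y : ℕ) : ℕ :=
  bound (codes.map (impPair c)) (row3 (codes.map (impPair c)) (impPair c x))
    (row3 (codes.map (impPair c)) (impPair c y))

theorem equiv3_mem {c x y : ℕ} (hc : c ∈ codes) (hx : x ∈ codes) (hy : y ∈ codes) :
    equiv3 (impPair c x) (impPair c y) ∈ codes :=
  join_mem (land_mem _ (impl_mem hx hc) _ (impl_mem hy hc))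
    (land_mem _ (impl_mem (compl_mem _ hx) hc) _ (impl_mem (compl_mem _ hy) hc))

theorem boundCode_mem {c x y : ℕ} (hc : c ∈ codes) (hx : x ∈ codes) (hy : y ∈ codes) :
    boundCode c x y ∈ codes := by
  have key : ∀ l : List ℕ, (∀ z ∈ l, z ∈ codes) → (l.map (impPair c)).foldr (fun w b => join b
      (equiv3 (impPair c x) w &&& equiv3 (impPair c y) w)) 0 ∈ codes := by
    intro l hl
    induction l with
    | nil => exact List.mem_cons_self
    | cons a l ih =>
      rw [List.forall_mem_cons] at hl
      exact join_mem (ih hl.2) (land_mem _ (equiv3_mem hc hx hl.1) _ (equiv3_mem hc hy hl.1))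
  rw [boundCode, bound, force_eq, force_eq, Bool.cond_eq_ite]
  split_ifs
  · exact equiv3_mem hc hx hy
  · exact key codes fun _ h => h

/-- `check_codes` tests the values that `bound` actually returns, so neither its shortcut nor its
description as a join needs a correctness proof. -/
theorem boundCode_spec {c x y : ℕ} (hc : c ∈ codes) (hx : x ∈ codes) (hy : y ∈ codes) :
    le (equiv3 (impPair c x) (impPair c y)) (boundCode c x y) = true ∧
      (∀ z ∈ codes, le (boundCode c x z &&& boundCode c y z) (boundCode c x y) = true) ∧
      le (impl x c &&& boundCode c x y) (impl y c) = true := by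
  have h := check_codes c hc
  rw [check_eq] at h
  simp only [List.all_map, List.all_eq_true, Function.comp_apply] at h
  have h' := h x hx y hy
  rw [isGood, force_eq, Bool.and_eq_true, Bool.and_eq_true] at h'
  obtain ⟨h1, h2, h3⟩ := h'
  refine ⟨h1, ?_, h3⟩
  simp only [row4, List.map_map] at h2
  exact le_of_le_pack (f := boundCode c x) (g := boundCode c y)
    (lt_of_mem _ (boundCode_mem hc hx hy))
    (fun z hz => lt_of_mem _ (boundCode_mem hc hx hz))
    (fun z hz => lt_of_mem _ (boundCode_mem hc hy hz)) h2

theorem isOA (n : ℕ) : Ortholattice.IsOA n Wheel := by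
  refine Ortholattice.isOA_of_transitive_bound (fun c => ?_) n
  refine ⟨fun x y => ⟨boundCode c.1 x.1 y.1, boundCode_mem c.2 x.2 y.2⟩, fun x y => ?_,
    fun x y z => ?_, fun x y => ?_⟩
  · exact le_def.2 (le_iff.1 (boundCode_spec c.2 x.2 y.2).1)
  · exact le_def.2 (le_iff.1 ((boundCode_spec c.2 x.2 y.2).2.1 z.1 z.2))
  · exact le_def.2 (le_iff.1 (boundCode_spec c.2 x.2 y.2).2.2)

/-! ### Failure of the Godowski and Mayet-Godowski equations -/

/-- The atoms `a, b, c, d, e, f` of the rim. -/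
def rim : ℕ → Wheel
  | 0 => ⟨128, by decide⟩
  | 1 => ⟨256, by decide⟩
  | 2 => ⟨512, by decide⟩
  | 3 => ⟨1024, by decide⟩
  | 4 => ⟨2048, by decide⟩
  -- Indices above 5 are never used below; their value is arbitrary.
  | _ => ⟨4096, by decide⟩

instance : DecidableEq Wheel := inferInstanceAs (DecidableEq {m : ℕ // m ∈ codes})

instance (a b : Wheel) : Decidable (Ortholattice.Orth a b) :=
  inferInstanceAs (Decidable (a.1 &&& (bᶜ).1 = a.1))

theorem not_isMGO : ¬ Ortholattice.IsMGO Wheel := by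
  intro h
  refine absurd (h Ortholattice.hexagonEquation rim ?_ ?_) ?_
  · change ∀ i : Fin 3, ∀ v ∈ (![{0, 1}, {2, 3}, {4, 5}] : Fin 3 → Finset ℕ) i,
      ∀ w ∈ (![{0, 1}, {2, 3}, {4, 5}] : Fin 3 → Finset ℕ) i, v ≠ w →
        Ortholattice.Orth (rim v) (rim w)
    decide +kernel
  · change ∀ i : Fin 3, ∀ v ∈ (![{1, 2}, {3, 4}, {5, 0}] : Fin 3 → Finset ℕ) i,
      ∀ w ∈ (![{1, 2}, {3, 4}, {5, 0}] : Fin 3 → Finset ℕ) i, v ≠ w →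
        Ortholattice.Orth (rim v) (rim w)
    decide +kernel
  -- The left side is p, the right side 0.
  · decide +kernel

theorem not_isGO_three : ¬ Ortholattice.IsGO 3 Wheel := by
  intro h
  -- The elements are b', d', f'. As b' ∩ d' = c, the implication b' → d' is b ∪ c and d' → b' is d
  -- ∪ c; cyclically, the two sides become those of the hexagon equation, in the opposite order.
  refine absurd (h fun i => (rim (2 * i - 1))ᶜ) ?_
  decide +kernel

end WheelLattice

theorem mainTheorem12 :
    ∃ (L : Type) (_ : OrthomodularLattice L),
      Finite L ∧
      (∀ n : ℕ, 3 ≤ n → n ≤ 6 → Ortholattice.IsOA n L) ∧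
      ¬ Ortholattice.IsGO 3 L ∧
      (∀ n : ℕ, 3 ≤ n → ¬ Ortholattice.IsGO n L) ∧
      ¬ Ortholattice.IsMGO L :=
  ⟨WheelLattice.Wheel, inferInstance, inferInstance, fun n _ _ => WheelLattice.isOA n,
    WheelLattice.not_isGO_three, fun _ hn h => WheelLattice.not_isGO_three (h.three hn),
    WheelLattice.not_isMGO⟩
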